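/- Let $I$ be an infinite set, let $\Delta_\omega\subset[0,1]^I$ be the convex hull of the unit vectors $e_k$ ($k\in I$), and for $\emptyset\ne K\subset I$ let $\Delta_K=\operatorname{co}\{e_k:k\in K\}$, all with the topology of pointwise convergence. For a set $Y$ put $\Delta(Y)=\Delta_\omega\times Y^I$, and for $A\subset Y$ put $\Delta(A)=\{(d,a)\in\Delta(Y): d_i\neq 0\Rightarrow a_i\in A,\ i\in I\}$. For $A\subset Y$ and $W\subset Y\times Y$ put $B(A,W)=\{y:(x,y)\in W\text{ for some }x\in A\}$. Let $Y$ be a uniform space and let $Z$ denote the set $Y$ with a second topology, not necessarily the uniform one. A continuous convexity $\kappa=(Y,C,Z)$ consists of a base $\mathcal B$ of the uniformity made of open entourages and of the smallest possible cardinality, a (possibly empty) family $\mathcal A$ of nonempty subsets of $Y$ (the admissible sets), a function $conv$ assigning to each $A\in\mathcal A$ a nonempty set $conv(A)\subset Y$, a set $Q'\subset\Delta(Y)$ containing $\Delta(B(A,W))$ for all $A\in\mathcal A$, $W\in\mathcal B$, and a multifunction $C:Q'\to Y$ such that (D) for every $a\in Y^I$ and every nonempty finite $K\subset I$ with $\Delta_K\times\{a\}\subset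 Q'$, the map $C(\cdot,a):\Delta_K\to Z$ is single-valued and continuous; (E) for every $U\in\mathcal B$ there is $W\in\mathcal B$ such that $C(\Delta(B(A,W)))\subset B(conv(A),U)$ for all $A\in\mathcal A$. The convexity is global if $Q'=\Delta(Y)$. For a topological space $X$ let $\mathcal F_\kappa(Y,X)$ be the class of all multifunctions $F:Y\to X$ such that for every nonempty finite $K\subset I$, every $a\in Y^I$ and every continuous $f:X\to\Delta_K$, the multifunction $f\circ F\circ C|_{\Delta_K\times\{a\}}:\Delta_K\to\Delta_K$ has a fixed point. **Proposition.** If $\kappa=(Y,C,Z)$ is a continuous global convexity and $X$ is a topological space, then $\mathcal F_\kappa(Y,X)$ contains every continuous function $\psi:Z\to X$ (regarded as the multifunction $y\mapsto\{\psi(y)\}$). -/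

import Mathlib

open Set Topology

universe u v w

namespace SetValuedConvexity

/-- `B(A, W) = ⋃_{x ∈ A} {y | (x, y) ∈ W}`, the `W`-neighbourhood of a set `A`. -/
def nbhd {Y : Type v} (A : Set Y) (W : Set (Y × Y)) : Set Y :=
  {y | ∃ x ∈ A, (x, y) ∈ W}

/-- An open base of the uniformity of `Y`: a family of entourages, open in `Y × Y`, such that
every entourage contains a member of the family. -/
def IsOpenUniformBase (Y : Type v) [UniformSpace Y] (B : Set (Set (Y × Y))) : Prop :=
  (∀ U ∈ B, U ∈ uniformity Y ∧ IsOpen U) ∧ ∀ V ∈ uniformity Y, ∃ U ∈ B, U ⊆ V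

/-- A minimal open base of the uniformity: one of smallest cardinality. -/
def IsMinimalOpenUniformBase (Y : Type v) [UniformSpace Y] (B : Set (Set (Y × Y))) : Prop :=
  IsOpenUniformBase Y B ∧
    ∀ B' : Set (Set (Y × Y)), IsOpenUniformBase Y B' → Cardinal.mk B ≤ Cardinal.mk B'

/-- The unit vector `e_k` of `[0,1]^I`. -/
noncomputable def unitVec {I : Type u} (k : I) : I → ℝ :=
  open scoped Classical in Pi.single k 1

/-- `Δ_K`: the convex hull of the unit vectors `e_k`, `k ∈ K`, with the topology of pointwise
convergence. -/
def face {I : Type u} (K : Set I) : Set (I → ℝ) :=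
  convexHull ℝ (unitVec '' K)

/-- `Δ_ω`: the simplex spanned by all unit vectors. -/
abbrev bigSimplex (I : Type u) : Set (I → ℝ) := face (univ : Set I)

/-- The inclusion of `Δ_K` in `Δ_ω`. -/
def inclFace {I : Type u} {K : Set I} (d : face K) : bigSimplex I :=
  ⟨d, convexHull_mono (image_mono (subset_univ K)) d.2⟩

/-- `Δ(Y) = Δ_ω × Y^ω`, the formal convex combinations of points of `Y`. -/
abbrev FormalComb (I : Type u) (Y : Type v) : Type (max u v) :=
  bigSimplex I × (I → Y)

/-- `Δ(A)`, the formal convex combinations of elements of `A`: the points that carry a nonzero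
coefficient lie in `A`. -/
def formalCombOf (I : Type u) {Y : Type v} (A : Set Y) : Set (FormalComb I Y) :=
  {p | ∀ i, p.1.1 i ≠ 0 → p.2 i ∈ A}

/-- A class of multifunctions between topological spaces. -/
abbrev MultifunctionClass : Type (max (u + 1) (v + 1)) :=
  ∀ (S : Type u) (_ : TopologicalSpace S) (T : Type v) (_ : TopologicalSpace T),
    (S → Set T) → Prop

/-- The class of all single-valued continuous maps. -/
def continuousMaps : MultifunctionClass.{u, v} := fun S _ T _ F =>
  ∃ g : S → T, Continuous g ∧ ∀ s, F s = {g s}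

/-- A convexity `κ = (Y, C, Z)` with respect to a class `V` of multifunctions. Here `Y` is a
uniform space, and `Z` is a topology on `Y` that need not be the uniform one. -/
structure Convexity (I : Type u) (Y : Type v) [UniformSpace Y] (Z : TopologicalSpace Y)
    (V : MultifunctionClass.{u, v}) where
  /-- the fixed minimal open base of the uniformity -/
  base : Set (Set (Y × Y))
  base_minimal : IsMinimalOpenUniformBase Y base
  /-- the admissible sets (there may be none) -/
  admissible : Set (Set Y)
  nonempty_of_admissible : ∀ A ∈ admissible, A.Nonempty
  /-- the convex hull of an admissible set -/
  conv : admissible → Set Y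
  conv_nonempty : ∀ A, (conv A).Nonempty
  /-- the set `Q'` of formal convex combinations at which `C` is defined -/
  domain : Set (FormalComb I Y)
  formalCombOf_subset_domain :
    ∀ A ∈ admissible, ∀ W ∈ base, formalCombOf I (nbhd A W) ⊆ domain
  /-- the convex combination multifunction `C : Q' → Y` -/
  C : domain → Set Y
  /-- condition (D) -/
  C_mem_class : ∀ (a : I → Y) (K : Finset I), K.Nonempty →
    ∀ h : ∀ d : face (K : Set I), (inclFace d, a) ∈ domain,
      V (face (K : Set I)) inferInstance Y Z (fun d => C ⟨(inclFace d, a), h d⟩)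
  /-- condition (E) -/
  C_subset_nbhd_conv : ∀ U ∈ base, ∃ W ∈ base, ∀ A : admissible, ∀ p : domain,
    p.1 ∈ formalCombOf I (nbhd A.1 W) → C p ⊆ nbhd (conv A) U

/-- A continuous convexity: one for the class of all single-valued continuous maps. -/
abbrev ContinuousConvexity (I : Type u) (Y : Type v) [UniformSpace Y]
    (Z : TopologicalSpace Y) : Type (max u v) :=
  Convexity I Y Z continuousMaps.{u, v}

namespace Convexity

variable {I : Type u} {Y : Type v} [UniformSpace Y] {Z : TopologicalSpace Y}
  {V : MultifunctionClass.{u, v}}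

/-- A convexity is global if `C` is defined on all of `Δ(Y)`. -/
def IsGlobal (κ : Convexity I Y Z V) : Prop := κ.domain = univ

/-- The multifunction `f ∘ F ∘ C|_{Δ_K × {a}} : Δ_K → Δ_K`. -/
def composite (κ : Convexity I Y Z V) {Y' : Set Y} {X : Type w} (F : Y' → Set X)
    (K : Set I) (a : I → Y) (f : X → face K) (d : face K) : Set (face K) :=
  {e | ∃ h : (inclFace d, a) ∈ κ.domain, ∃ y : Y', y.1 ∈ κ.C ⟨(inclFace d, a), h⟩ ∧
    ∃ x ∈ F y, f x = e}

/-- The class `𝓕_κ(Y', X)`: the multifunctions `F : Y' → X` such that, for every finite simplex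
`Δ_K`, every `a ∈ (Y')^ω` and every continuous `f : X → Δ_K`, the multifunction
`f ∘ F ∘ C|_{Δ_K × {a}}` has a fixed point. -/
def fixedPointClass (κ : Convexity I Y Z V) (Y' : Set Y) (X : Type w) [TopologicalSpace X] :
    Set (Y' → Set X) :=
  {F | ∀ K : Finset I, K.Nonempty → ∀ a : I → Y, (∀ i, a i ∈ Y') →
    ∀ f : X → face (K : Set I), Continuous f →
      ∃ d : face (K : Set I), d ∈ κ.composite F K a f d}

end Convexity

end SetValuedConvexity

/-!
A continuous convexity turns `C(·, a)` into a continuous map `Δ_K → Z`, so `f ∘ ψ ∘ C(·, a)` is a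
continuous self-map of a finite-dimensional simplex and the proposition is Brouwer's fixed point
theorem.

Brouwer's theorem is obtained from Scarf's lemma: if the points of a finite set are coloured by
`ι` and ranked by each `i : ι`, then some subset `σ` is such that no point exceeds the least
element of `σ` in every ranking that is a colour of `σ`. Ranking a fine net in the simplex by the
coordinates, and colouring `x` by some `i` with `x i ≤ f x i`, one finds a point `p` near which each
colour `i` with `p i ≠ 0` occurs. By compactness there is a point `p` with `p i ≤ f p i` for all
`i`; since both sides sum to `1`, it is a fixed point.

Scarf's lemma itself is a parity count. With the rankings extended to slack points, one for each
`i`, consider the sets with one element less than there are rankings which carry precisely the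
colours other than `k`. Such a set extends by a point to an even number of dominant sets, unless
it consists of slack points, when it does so in exactly one way. On the other hand a dominant set
that misses a colour contains an even number of them.
-/

namespace Scarf

variable {T ι α : Type*}

theorem image_erase_eq_image [DecidableEq T] [DecidableEq ι] {c : T → ι} {σ : Finset T} {x y : T}
    (hy : y ∈ σ) (hyx : y ≠ x) (hc : c y = c x) : (σ.erase x).image c = σ.image c := by
  refine (Finset.image_subset_image (Finset.erase_subset x σ)).antisymm ?_
  rw [Finset.image_subset_iff]
  intro z hz
  rcases eq_or_ne z x with rfl | hzx
  · exact hc ▸ Finset.mem_image_of_mem c (Finset.mem_erase.2 ⟨hyx, hy⟩)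
  · exact Finset.mem_image_of_mem c (Finset.mem_erase.2 ⟨hzx, hz⟩)

section Colouring

variable [Fintype ι] [DecidableEq ι] {c : T → ι} {k : ι} {τ : Finset T}

/-- The facets of Sperner's parity argument: `τ` carries each colour other than `k` exactly once,
and does not carry `k`. The colours are counted by cardinality, injectivity of `c` on `τ` being
a consequence. -/
structure IsAlmostRainbow (c : T → ι) (k : ι) (τ : Finset T) : Prop where
  card_add_one : τ.card + 1 = Fintype.card ι
  image_eq : τ.image c = Finset.univ.erase k

theorem IsAlmostRainbow.injOn (h : IsAlmostRainbow c k τ) : InjOn c τ := by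
  rw [← Finset.card_image_iff, h.image_eq, Finset.card_erase_of_mem (Finset.mem_univ k),
    Finset.card_univ, ← h.card_add_one, Nat.add_sub_cancel]

theorem even_card_isAlmostRainbow_erase [DecidableEq T] (c : T → ι) (k : ι)
    [DecidablePred (IsAlmostRainbow c k)] {σ : Finset T} (hσ : σ.image c ≠ Finset.univ) :
    Even (σ.filter fun x => IsAlmostRainbow c k (σ.erase x)).card := by
  rcases (σ.filter fun x => IsAlmostRainbow c k (σ.erase x)).eq_empty_or_nonempty
    with hempty | ⟨x, hx⟩
  · simp only [hempty, Finset.card_empty, Even.zero]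
  obtain ⟨hxσ, hxk⟩ := Finset.mem_filter.1 hx
  have hcx : c x ≠ k := by
    rintro rfl
    rw [← Finset.insert_erase hxσ, Finset.image_insert, hxk.image_eq,
      Finset.insert_erase (Finset.mem_univ _)] at hσ
    exact hσ rfl
  obtain ⟨y, hy, hyx⟩ : ∃ y ∈ σ.erase x, c y = c x := by
    rw [← Finset.mem_image, hxk.image_eq]
    exact Finset.mem_erase.2 ⟨hcx, Finset.mem_univ _⟩
  obtain ⟨hne, hyσ⟩ := Finset.mem_erase.1 hy
  have hyk : IsAlmostRainbow c k (σ.erase y) :=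
    ⟨by rw [← hxk.card_add_one, Finset.card_erase_of_mem hyσ, Finset.card_erase_of_mem hxσ],
      by rw [image_erase_eq_image hxσ hne.symm hyx.symm, ← image_erase_eq_image hyσ hne hyx,
        hxk.image_eq]⟩
  have hpair : σ.filter (fun x => IsAlmostRainbow c k (σ.erase x)) = {x, y} := by
    ext z
    rw [Finset.mem_filter, Finset.mem_insert, Finset.mem_singleton]
    constructor
    · rintro ⟨-, hz⟩
      by_contra! hzxy
      exact hne (hz.injOn (Finset.mem_erase.2 ⟨hzxy.2.symm, hyσ⟩)
        (Finset.mem_erase.2 ⟨hzxy.1.symm, hxσ⟩) hyx)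
    · rintro (rfl | rfl)
      exacts [⟨hxσ, hxk⟩, ⟨hyσ, hyk⟩]
  rw [hpair, Finset.card_pair hne.symm]
  exact even_two

end Colouring

theorem sum_card_insert_eq_sum_card_erase [Fintype T] [DecidableEq T] (P Q : Finset T → Prop)
    [DecidablePred P] [DecidablePred Q] :
    ∑ τ with P τ, (Finset.univ.filter fun y => y ∉ τ ∧ Q (insert y τ)).card =
      ∑ σ with Q σ, (σ.filter fun x => P (σ.erase x)).card := by
  simp only [← Finset.card_sigma]
  refine Finset.card_nbij' (fun p => ⟨insert p.2 p.1, p.2⟩) (fun p => ⟨p.1.erase p.2, p.2⟩)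
    ?_ ?_ ?_ ?_
  · rintro ⟨τ, y⟩ h
    simp_all
  · rintro ⟨σ, x⟩ h
    simp_all
  · rintro ⟨τ, y⟩ h
    simp_all
  · rintro ⟨σ, x⟩ h
    simp_all

section Dominant

variable [LinearOrder α] {r : ι → T → α} {σ τ : Finset T} {m : ι → T} {a b j : ι} {y z : T}

/-- Dominance in the sense of Scarf: no point lies above the least element of `σ` in every one of
the rankings `r i`. -/
def Dominant (r : ι → T → α) (σ : Finset T) : Prop :=
  ∀ y, ∃ i, ∀ x ∈ σ, r i y ≤ r i x

theorem Dominant.mono (h : Dominant r σ) (hτ : τ ⊆ σ) : Dominant r τ := fun y =>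
  (h y).imp fun _ hi x hx => hi x (hτ hx)

/-- `m i` is the least element of `τ` in the ranking `r i`, for every `i`. -/
structure IsMinSelection (r : ι → T → α) (τ : Finset T) (m : ι → T) : Prop where
  mem : ∀ i, m i ∈ τ
  le : ∀ i, ∀ x ∈ τ, r i (m i) ≤ r i x

theorem exists_isMinSelection (r : ι → T → α) (hτ : τ.Nonempty) : ∃ m, IsMinSelection r τ m := by
  choose m hmem hle using fun i => τ.exists_min_image (r i) hτ
  exact ⟨m, hmem, hle⟩

theorem IsMinSelection.eq_of_le (hr : ∀ i, Function.Injective (r i)) (hm : IsMinSelection r τ m)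
    {i : ι} (hy : y ∈ τ) (hle : ∀ x ∈ τ, r i y ≤ r i x) : m i = y :=
  hr i ((hm.le i y hy).antisymm (hle _ (hm.mem i)))

theorem IsMinSelection.exists_eq (hr : ∀ i, Function.Injective (r i)) (hm : IsMinSelection r τ m)
    (hd : Dominant r τ) (hy : y ∈ τ) : ∃ i, m i = y :=
  (hd y).imp fun _ => hm.eq_of_le hr hy

theorem IsMinSelection.injective [Fintype ι] (hr : ∀ i, Function.Injective (r i))
    (hm : IsMinSelection r τ m) (hd : Dominant r τ) (hcard : τ.card = Fintype.card ι) :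
    Function.Injective m := by
  classical
  have himage : Finset.univ.image m = τ := by
    ext x
    simp only [Finset.mem_image, Finset.mem_univ, true_and]
    exact ⟨fun ⟨i, hi⟩ => hi ▸ hm.mem i, hm.exists_eq hr hd⟩
  rw [← Set.injOn_univ, ← Finset.coe_univ, ← Finset.card_image_iff, himage, hcard,
    Finset.card_univ]

/-- Scarf's ordinal pivot: `y` is the greatest in the ranking `r a` among the points that exceed
`m i` in every other ranking `r i`. -/
structure IsPivot (r : ι → T → α) (m : ι → T) (a : ι) (y : T) : Prop where
  lt : ∀ i, i ≠ a → r i (m i) < r i y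
  max : ∀ z, (∀ i, i ≠ a → r i (m i) < r i z) → r a z ≤ r a y

theorem exists_isPivot [Finite T] (hz : ∀ i, i ≠ a → r i (m i) < r i z) :
    ∃ y, IsPivot r m a y := by
  obtain ⟨y, hy, hmax⟩ := Set.exists_max_image {z | ∀ i, i ≠ a → r i (m i) < r i z} (r a)
    (Set.toFinite _) ⟨z, hz⟩
  exact ⟨y, hy, hmax⟩

theorem IsPivot.unique (hr : Function.Injective (r a)) (hy : IsPivot r m a y)
    (hz : IsPivot r m a z) : y = z :=
  hr ((hz.max y hy.lt).antisymm (hy.max z hz.lt))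

theorem IsPivot.le (hy : IsPivot r m a y) (hm : IsMinSelection r τ m) (hd : Dominant r τ) :
    r a y ≤ r a (m a) := by
  obtain ⟨i, hi⟩ := hd y
  rcases eq_or_ne i a with rfl | hia
  · exact hi _ (hm.mem i)
  · exact absurd (hi _ (hm.mem i)) (hy.lt i hia).not_ge

theorem IsPivot.notMem (hy : IsPivot r m a y) (hr : ∀ i, Function.Injective (r i))
    (hm : IsMinSelection r τ m) (hd : Dominant r τ) (hab : a ≠ b) (hmab : m a = m b) :
    y ∉ τ := by
  intro hyτ
  obtain ⟨i, rfl⟩ := hm.exists_eq hr hd hyτ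
  rcases eq_or_ne i a with rfl | hia
  · exact (hy.lt b hab.symm).ne (hmab ▸ rfl)
  · exact (hy.lt i hia).false

theorem IsPivot.dominant_insert [DecidableEq T] (hy : IsPivot r m a y)
    (hm : IsMinSelection r τ m) (hd : Dominant r τ) : Dominant r (insert y τ) := by
  intro z
  by_cases hz : ∀ i, i ≠ a → r i (m i) < r i z
  · refine ⟨a, Finset.forall_mem_insert _ _ _ |>.2 ⟨hy.max z hz, fun x hx => ?_⟩⟩
    exact (hy.max z hz).trans ((hy.le hm hd).trans (hm.le a x hx))
  · push Not at hz
    obtain ⟨i, hia, hle⟩ := hz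
    exact ⟨i, Finset.forall_mem_insert _ _ _ |>.2
      ⟨hle.trans (hy.lt i hia).le, fun x hx => hle.trans (hm.le i x hx)⟩⟩

theorem Dominant.isPivot_of_insert [Fintype ι] [DecidableEq T]
    (hr : ∀ i, Function.Injective (r i)) (hm : IsMinSelection r τ m)
    (hcard : τ.card + 1 = Fintype.card ι) (hab : a ≠ b) (hmab : m a = m b) (hyτ : y ∉ τ)
    (hd : Dominant r (insert y τ)) : IsPivot r m a y ∨ IsPivot r m b y := by
  obtain ⟨m', hm'⟩ := exists_isMinSelection r (Finset.insert_nonempty y τ)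
  have hinj : Function.Injective m' :=
    hm'.injective hr hd (by rw [Finset.card_insert_of_notMem hyτ, hcard])
  obtain ⟨j, hj⟩ := hm'.exists_eq hr hd (Finset.mem_insert_self y τ)
  have heq : ∀ i, i ≠ j → m i = m' i := fun i hij =>
    hm.eq_of_le hr (Finset.mem_of_mem_insert_of_ne (hm'.mem i) (hj ▸ hinj.ne hij))
      fun x hx => hm'.le i x (Finset.mem_insert_of_mem hx)
  have hpivot : IsPivot r m j y := by
    refine ⟨fun i hij => ?_, fun z hz => ?_⟩
    · rw [heq i hij]
      exact (hm'.le i y (Finset.mem_insert_self y τ)).lt_of_ne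
        ((hr i).ne (hj ▸ hinj.ne hij))
    · obtain ⟨i, hi⟩ := hd z
      obtain rfl : i = j := by
        by_contra hij
        exact (hz i hij).not_ge (hi _ (Finset.mem_insert_of_mem (hm.mem i)))
      exact hi y (Finset.mem_insert_self y τ)
  have hjab : j = a ∨ j = b := by
    by_contra! h
    exact hab (hinj (by rw [← heq a h.1.symm, ← heq b h.2.symm, hmab]))
  rcases hjab with rfl | rfl
  exacts [.inl hpivot, .inr hpivot]

theorem Dominant.card_insert_eq_two [Fintype T] [DecidableEq T] [Fintype ι]
    [DecidablePred (Dominant r)] (hr : ∀ i, Function.Injective (r i)) (hm : IsMinSelection r τ m)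
    (hd : Dominant r τ) (hcard : τ.card + 1 = Fintype.card ι)
    (habove : ∀ a, ∃ z, ∀ i, i ≠ a → r i (m i) < r i z) :
    (Finset.univ.filter fun y => y ∉ τ ∧ Dominant r (insert y τ)).card = 2 := by
  obtain ⟨a, -, b, -, hab, hmab⟩ := Finset.exists_ne_map_eq_of_card_lt_of_maps_to
    (s := Finset.univ) (t := τ) (f := m) (by rw [Finset.card_univ]; lia) fun i _ => hm.mem i
  obtain ⟨y, hy⟩ := exists_isPivot (habove a).choose_spec
  obtain ⟨z, hz⟩ := exists_isPivot (habove b).choose_spec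
  have hyz : y ≠ z := by
    rintro rfl
    exact (hy.lt b hab.symm).not_ge (hz.le hm hd)
  rw [Finset.card_eq_two]
  refine ⟨y, z, hyz, ?_⟩
  ext x
  simp only [Finset.mem_filter, Finset.mem_univ, true_and, Finset.mem_insert,
    Finset.mem_singleton]
  constructor
  · rintro ⟨hxτ, hx⟩
    exact (hx.isPivot_of_insert hr hm hcard hab hmab hxτ).imp
      (fun h => h.unique (hr a) hy) (fun h => h.unique (hr b) hz)
  · rintro (rfl | rfl)
    · exact ⟨hy.notMem hr hm hd hab hmab, hy.dominant_insert hm hd⟩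
    · exact ⟨hz.notMem hr hm hd hab.symm hmab.symm, hz.dominant_insert hm hd⟩

end Dominant

section Slack

variable [LinearOrder α] {r : ι → T ⊕ ι → α} {τ : Finset (T ⊕ ι)} {k : ι}

/-- Injective rankings of a set `T` enlarged by slack points, one for each ranking: the slack
point of `i` is the least in the ranking `r i`, and exceeds all of `T` in the other rankings. -/
structure IsSlackRanking (r : ι → T ⊕ ι → α) : Prop where
  injective : ∀ i, Function.Injective (r i)
  slack_le : ∀ i t, r i (.inr i) ≤ r i t
  lt_slack : ∀ i j, j ≠ i → ∀ x, r i (.inl x) < r i (.inr j)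

theorem IsSlackRanking.slack_lt (hr : IsSlackRanking r) {i : ι} {t : T ⊕ ι} (ht : t ≠ .inr i) :
    r i (.inr i) < r i t :=
  (hr.slack_le i t).lt_of_ne ((hr.injective i).ne ht.symm)

theorem IsSlackRanking.lt_slack_of_isMinSelection (hr : IsSlackRanking r) {m : ι → T ⊕ ι}
    (hm : IsMinSelection r τ m) {x : T} (hx : .inl x ∈ τ) {a i : ι} (hia : i ≠ a) :
    r i (m i) < r i (.inr a) :=
  (hm.le i _ hx).trans_lt (hr.lt_slack i a hia.symm x)

theorem IsSlackRanking.even_card_insert [Fintype T] [DecidableEq T] [Fintype ι] [DecidableEq ι]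
    [DecidablePred (Dominant r)] (hr : IsSlackRanking r) (hcard : τ.card + 1 = Fintype.card ι)
    {x : T} (hx : .inl x ∈ τ) :
    Even (Finset.univ.filter fun y => y ∉ τ ∧ Dominant r (insert y τ)).card := by
  by_cases hd : Dominant r τ
  · obtain ⟨m, hm⟩ := exists_isMinSelection r ⟨_, hx⟩
    rw [hd.card_insert_eq_two hr.injective hm hcard fun a =>
      ⟨.inr a, fun i => hr.lt_slack_of_isMinSelection hm hx⟩]
    exact even_two
  · rw [Finset.filter_false_of_mem fun y _ h => hd (h.2.mono (Finset.subset_insert y τ))]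
    exact Even.zero

/-- The facet of all slack points but that of `k`. -/
def slackFacet [Fintype ι] [DecidableEq ι] (T : Type*) (k : ι) : Finset (T ⊕ ι) :=
  (Finset.univ.erase k).map .inr

theorem inr_mem_slackFacet [Fintype ι] [DecidableEq ι] {j : ι} :
    (.inr j : T ⊕ ι) ∈ slackFacet T k ↔ j ≠ k := by
  simp [slackFacet]

theorem inl_notMem_slackFacet [Fintype ι] [DecidableEq ι] {x : T} :
    (.inl x : T ⊕ ι) ∉ slackFacet T k := by
  simp [slackFacet]

theorem IsSlackRanking.dominant_insert_slackFacet [Fintype ι] [DecidableEq ι] [DecidableEq T]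
    (hr : IsSlackRanking r) {x : T} (hx : ∀ y, r k (.inl y) ≤ r k (.inl x)) :
    Dominant r (insert (.inl x) (slackFacet T k)) := by
  rintro (y | j)
  · refine ⟨k, Finset.forall_mem_insert _ _ _ |>.2 ⟨hx y, ?_⟩⟩
    rintro (z | j) hz
    · exact absurd hz inl_notMem_slackFacet
    · exact (hr.lt_slack k j (inr_mem_slackFacet.1 hz) y).le
  · exact ⟨j, fun t _ => hr.slack_le j t⟩

theorem IsSlackRanking.eq_of_dominant_insert_slackFacet [Fintype ι] [DecidableEq ι]
    [DecidableEq T] (hr : IsSlackRanking r) {x : T} (hx : ∀ y, r k (.inl y) ≤ r k (.inl x))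
    {t : T ⊕ ι} (ht : t ∉ slackFacet T k) (hd : Dominant r (insert t (slackFacet T k))) :
    t = .inl x := by
  obtain ⟨i, hi⟩ := hd (.inl x)
  obtain rfl : i = k := by
    by_contra hik
    exact (hr.slack_lt Sum.inl_ne_inr).not_ge
      (hi _ (Finset.mem_insert_of_mem (inr_mem_slackFacet.2 hik)))
  have hxt := hi t (Finset.mem_insert_self _ _)
  rcases t with y | j
  · exact hr.injective i ((hx y).antisymm hxt)
  · obtain rfl : j = i := not_not.1 (mt inr_mem_slackFacet.2 ht)
    exact absurd hxt (hr.slack_lt Sum.inl_ne_inr).not_ge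

theorem IsSlackRanking.card_insert_slackFacet [Fintype T] [DecidableEq T] [Nonempty T]
    [Fintype ι] [DecidableEq ι] [DecidablePred (Dominant r)] (hr : IsSlackRanking r) (k : ι) :
    (Finset.univ.filter fun y =>
      y ∉ slackFacet T k ∧ Dominant r (insert y (slackFacet T k))).card = 1 := by
  obtain ⟨x, hx⟩ := Finite.exists_max fun x => r k (.inl x)
  rw [Finset.card_eq_one]
  refine ⟨.inl x, ?_⟩
  ext t
  simp only [Finset.mem_filter, Finset.mem_univ, true_and, Finset.mem_singleton]
  constructor
  · exact fun ⟨ht, hd⟩ => hr.eq_of_dominant_insert_slackFacet hx ht hd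
  · rintro rfl
    exact ⟨inl_notMem_slackFacet, hr.dominant_insert_slackFacet hx⟩

theorem isAlmostRainbow_slackFacet [Fintype ι] [DecidableEq ι] (c : T → ι) (k : ι) :
    IsAlmostRainbow (Sum.elim c id) k (slackFacet T k) where
  card_add_one := by
    rw [slackFacet, Finset.card_map, Finset.card_erase_add_one (Finset.mem_univ k),
      Finset.card_univ]
  image_eq := by
    ext i
    simp [slackFacet]

theorem IsAlmostRainbow.eq_slackFacet [Fintype ι] [DecidableEq ι] {c : T → ι}
    (h : IsAlmostRainbow (Sum.elim c id) k τ) (hτ : ∀ x, .inl x ∉ τ) : τ = slackFacet T k := by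
  ext (x | j)
  · exact iff_of_false (hτ x) inl_notMem_slackFacet
  · have hj : j ∈ τ.image (Sum.elim c id) ↔ j ≠ k := by
      rw [h.image_eq]
      simp
    rw [inr_mem_slackFacet, ← hj, Finset.mem_image]
    refine ⟨fun hjτ => ⟨_, hjτ, rfl⟩, ?_⟩
    rintro ⟨x | i, hi, rfl⟩
    exacts [absurd hi (hτ x), hi]

theorem IsSlackRanking.exists_dominant_image_eq_univ [Finite T] [Nonempty T] [Fintype ι]
    [DecidableEq ι] (hr : IsSlackRanking r) (c : T → ι) :
    ∃ σ : Finset (T ⊕ ι), Dominant r σ ∧ σ.image (Sum.elim c id) = Finset.univ := by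
  classical
  cases nonempty_fintype T
  let k := c (Classical.arbitrary T)
  by_contra! hmiss
  have heven : Even (∑ σ with Dominant r σ,
      (σ.filter fun x => IsAlmostRainbow (Sum.elim c id) k (σ.erase x)).card) :=
    Finset.even_sum _ fun σ hσ =>
      even_card_isAlmostRainbow_erase _ k (hmiss σ (Finset.mem_filter.1 hσ).2)
  rw [← sum_card_insert_eq_sum_card_erase (IsAlmostRainbow _ _) (Dominant r),
    ← Finset.add_sum_erase _ _
      (Finset.mem_filter.2 ⟨Finset.mem_univ _, isAlmostRainbow_slackFacet c k⟩),
    hr.card_insert_slackFacet] at heven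
  refine Nat.not_even_iff_odd.2 (odd_one.add_even (Finset.even_sum _ fun τ hτ => ?_)) heven
  obtain ⟨hne, hmem⟩ := Finset.mem_erase.1 hτ
  have hτ := (Finset.mem_filter.1 hmem).2
  obtain ⟨x, hx⟩ : ∃ x, .inl x ∈ τ := by
    by_contra! h
    exact hne (hτ.eq_slackFacet h)
  exact hr.even_card_insert hτ.card_add_one hx

/-- The rankings of `T` extended to slack points, with ties broken by an enumeration. -/
noncomputable def slackRank [Fintype T] [Fintype ι] [DecidableEq ι] (r : ι → T → α) (i : ι)
    (t : T ⊕ ι) : WithBot (WithTop α) ×ₗ Fin (Fintype.card (T ⊕ ι)) :=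
  toLex (Sum.elim (fun x => ((r i x : WithTop α) : WithBot (WithTop α)))
    (fun j => if j = i then ⊥ else ((⊤ : WithTop α) : WithBot (WithTop α))) t,
    Fintype.equivFin (T ⊕ ι) t)

theorem isSlackRanking_slackRank [Fintype T] [Fintype ι] [DecidableEq ι] (r : ι → T → α) :
    IsSlackRanking (slackRank r) where
  injective i s t h :=
    (Fintype.equivFin (T ⊕ ι)).injective (congrArg (fun p => (ofLex p).2) h)
  slack_le i t := by
    rcases t with x | j
    · exact (Prod.Lex.toLex_lt_toLex.2 (.inl (by simp))).le
    · rcases eq_or_ne j i with rfl | hj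
      · exact le_rfl
      · exact (Prod.Lex.toLex_lt_toLex.2 (.inl (by simp [hj]))).le
  lt_slack i j hj x := Prod.Lex.toLex_lt_toLex.2 (.inl (by
    rw [Sum.elim_inl, Sum.elim_inr, if_neg hj]
    exact WithBot.coe_lt_coe.2 (WithTop.coe_lt_top _)))

theorem le_of_slackRank_inl_le [Fintype T] [Fintype ι] [DecidableEq ι] {r : ι → T → α} {i : ι}
    {x y : T} (h : slackRank r i (.inl x) ≤ slackRank r i (.inl y)) : r i x ≤ r i y := by
  have hfst := Prod.Lex.monotone_fst _ _ h
  simpa [slackRank] using hfst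

end Slack

/-- **Scarf's lemma.** -/
theorem exists_finset_forall_exists_le [LinearOrder α] [Finite T] [Nonempty T] [Finite ι]
    (r : ι → T → α) (c : T → ι) :
    ∃ σ : Finset T, ∀ y, ∃ x₀ ∈ σ, ∀ x ∈ σ, r (c x₀) y ≤ r (c x₀) x := by
  classical
  cases nonempty_fintype T
  cases nonempty_fintype ι
  have hr := isSlackRanking_slackRank r
  obtain ⟨σ, hσ, himage⟩ := hr.exists_dominant_image_eq_univ c
  refine ⟨σ.toLeft, fun y => ?_⟩
  obtain ⟨i, hi⟩ := hσ (.inl y)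
  have hslack : .inr i ∉ σ := fun h => (hr.slack_lt Sum.inl_ne_inr).not_ge (hi _ h)
  obtain ⟨x₀ | j, hx₀, rfl⟩ := Finset.mem_image.1 (himage ▸ Finset.mem_univ i)
  · exact ⟨x₀, Finset.mem_toLeft.2 hx₀, fun x hx =>
      le_of_slackRank_inl_le (hi _ (Finset.mem_toLeft.1 hx))⟩
  · exact absurd hx₀ hslack

end Scarf

section Brouwer

variable {ι : Type*} [Fintype ι]

theorem dist_le_card_mul_of_forall_le_add {x p : stdSimplex ℝ ι} {δ : ℝ}
    (h : ∀ i, p i ≤ x i + δ) : dist x p ≤ Fintype.card ι * δ := by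
  have hsum : ∑ i, (x i + δ - p i) = Fintype.card ι * δ := by
    rw [Finset.sum_sub_distrib, Finset.sum_add_distrib, stdSimplex.sum_eq_one,
      stdSimplex.sum_eq_one, Finset.sum_const, Finset.card_univ, nsmul_eq_mul]
    ring
  have hnonneg : ∀ i, 0 ≤ x i + δ - p i := fun i => sub_nonneg.2 (h i)
  have hle : ∀ i, x i + δ - p i ≤ Fintype.card ι * δ := fun i =>
    hsum ▸ Finset.single_le_sum (fun j _ => hnonneg j) (Finset.mem_univ i)
  have hι : Nonempty ι := by
    by_contra hempty
    rw [not_nonempty_iff] at hempty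
    simpa using stdSimplex.sum_eq_one x
  have hcard : (1 : ℝ) ≤ Fintype.card ι := Nat.one_le_cast.2 Fintype.card_pos
  have hδ : 0 ≤ δ := nonneg_of_mul_nonneg_right
    (hsum ▸ Finset.sum_nonneg fun i _ => hnonneg i) (zero_lt_one.trans_le hcard)
  have hδn : δ ≤ Fintype.card ι * δ := le_mul_of_one_le_left hδ hcard
  refine (dist_pi_le_iff (by positivity)).2 fun i => ?_
  have hlower : -(Fintype.card ι * δ) ≤ x i - p i := by linarith [h i]
  have hupper : x i - p i ≤ Fintype.card ι * δ := by linarith [hle i]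
  exact abs_le.2 ⟨hlower, hupper⟩

theorem exists_stdSimplex_eq_add_of_sum_le_one {C : Finset ι} (hC : C.Nonempty) {m : ι → ℝ}
    (hm : ∀ i ∈ C, 0 ≤ m i) (hsum : ∑ i ∈ C, m i ≤ 1) :
    ∃ (p : stdSimplex ℝ ι) (t : ℝ), (∀ i ∈ C, p i = m i + t) ∧ ∀ i ∉ C, p i = 0 := by
  classical
  have hcard : (0 : ℝ) < C.card := Nat.cast_pos.2 hC.card_pos
  let t : ℝ := (1 - ∑ i ∈ C, m i) / C.card
  have ht : 0 ≤ t := div_nonneg (sub_nonneg.2 hsum) hcard.le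
  let p : ι → ℝ := fun i => if i ∈ C then m i + t else 0
  have hp : p ∈ stdSimplex ℝ ι := by
    refine ⟨fun i => ?_, ?_⟩
    · by_cases hi : i ∈ C
      · exact (if_pos hi).ge.trans' (add_nonneg (hm i hi) ht)
      · exact (if_neg hi).ge
    · rw [Finset.sum_ite_mem, Finset.univ_inter, Finset.sum_add_distrib, Finset.sum_const,
        nsmul_eq_mul, mul_div_cancel₀ _ hcard.ne']
      ring
  exact ⟨⟨p, hp⟩, t, fun i hi => if_pos hi, fun i hi => if_neg hi⟩

theorem exists_finset_forall_exists_lt_add [Nonempty ι] (c : stdSimplex ℝ ι → ι) {δ : ℝ}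
    (hδ : 0 < δ) :
    ∃ σ : Finset (stdSimplex ℝ ι), ∀ q : stdSimplex ℝ ι, ∃ x₀ ∈ σ, ∀ x ∈ σ,
      q (c x₀) < x (c x₀) + δ := by
  obtain ⟨N, -, hfin, hN⟩ := finite_cover_balls_of_compact
    (isCompact_univ (X := stdSimplex ℝ ι)) hδ
  have hnet : ∀ q : stdSimplex ℝ ι, ∃ y ∈ N, dist q y < δ := fun q => by
    simpa using hN (mem_univ q)
  have : Finite N := hfin
  obtain ⟨y, hy, -⟩ := hnet (Classical.arbitrary _)
  have : Nonempty N := ⟨⟨y, hy⟩⟩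
  obtain ⟨σ, hσ⟩ := Scarf.exists_finset_forall_exists_le (fun i (x : N) => x.1 i) fun x => c x
  refine ⟨σ.map (Function.Embedding.subtype _), fun q => ?_⟩
  obtain ⟨y, hy, hqy⟩ := hnet q
  obtain ⟨x₀, hx₀, hle⟩ := hσ ⟨y, hy⟩
  refine ⟨x₀, Finset.mem_map_of_mem _ hx₀, fun x hx => ?_⟩
  obtain ⟨x, hxσ, rfl⟩ := Finset.mem_map.1 hx
  have hcoord : |q (c x₀) - y (c x₀)| < δ := (dist_le_pi_dist q.1 y.1 (c x₀)).trans_lt hqy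
  have hyx : y (c x₀) ≤ x.1 (c x₀) := hle x hxσ
  change q (c x₀) < x.1 (c x₀) + δ
  linarith [(abs_lt.1 hcoord).2]

theorem exists_forall_ne_zero_exists_dist_lt [Nonempty ι] (c : stdSimplex ℝ ι → ι) {ε : ℝ}
    (hε : 0 < ε) :
    ∃ p : stdSimplex ℝ ι, ∀ i, p i ≠ 0 → ∃ x, dist x p < ε ∧ c x = i := by
  classical
  let δ : ℝ := ε / (Fintype.card ι + 1)
  have hδ : 0 < δ := by positivity
  have hδε : Fintype.card ι * δ < ε := by
    have : (Fintype.card ι + 1) * δ = ε := mul_div_cancel₀ _ (by positivity)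
    linarith
  obtain ⟨σ, hσ⟩ := exists_finset_forall_exists_lt_add c hδ
  obtain ⟨x₁, hx₁, -⟩ := hσ (Classical.arbitrary _)
  choose m hmσ hm using fun i => σ.exists_min_image (fun x => x i) ⟨x₁, hx₁⟩
  have hsum : ∑ i ∈ σ.image c, m i i ≤ 1 := calc
    ∑ i ∈ σ.image c, m i i ≤ ∑ i ∈ σ.image c, x₁ i :=
      Finset.sum_le_sum fun i _ => hm i x₁ hx₁
    _ ≤ ∑ i, x₁ i := Finset.sum_le_univ_sum_of_nonneg fun i => stdSimplex.zero_le x₁ i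
    _ = 1 := stdSimplex.sum_eq_one x₁
  obtain ⟨p, t, hpC, hp⟩ := exists_stdSimplex_eq_add_of_sum_le_one
    ⟨_, Finset.mem_image_of_mem c hx₁⟩ (fun i _ => stdSimplex.zero_le (m i) i) hsum
  have ht : t < δ := by
    obtain ⟨x₀, hx₀, hlt⟩ := hσ p
    have := hlt _ (hmσ (c x₀))
    rw [hpC _ (Finset.mem_image_of_mem c hx₀)] at this
    linarith
  have hnear : ∀ x ∈ σ, dist x p < ε := fun x hx => by
    refine (dist_le_card_mul_of_forall_le_add fun i => ?_).trans_lt hδε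
    by_cases hi : i ∈ σ.image c
    · rw [hpC i hi]
      exact add_le_add (hm i x hx) ht.le
    · rw [hp i hi]
      exact add_nonneg (stdSimplex.zero_le x i) hδ.le
  refine ⟨p, fun i hi => ?_⟩
  obtain ⟨x, hx, hxi⟩ := Finset.mem_image.1 (not_imp_comm.1 (hp i) hi)
  exact ⟨x, hnear x hx, hxi⟩

/-- A form of the **Knaster–Kuratowski–Mazurkiewicz lemma**. -/
theorem exists_forall_ne_zero_mem_of_isClosed [Nonempty ι] {F : ι → Set (stdSimplex ℝ ι)}
    (hF : ∀ i, IsClosed (F i)) (hcover : ∀ x, ∃ i, x ∈ F i) :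
    ∃ p : stdSimplex ℝ ι, ∀ i, p i ≠ 0 → p ∈ F i := by
  by_contra! h
  choose c hc using hcover
  have hopen : ∀ i, IsOpen {p : stdSimplex ℝ ι | p i ≠ 0 ∧ p ∉ F i} := fun i =>
    (isOpen_ne_fun ((continuous_apply i).comp continuous_subtype_val) continuous_const).inter
      (hF i).isOpen_compl
  obtain ⟨ε, hε, hball⟩ := lebesgue_number_lemma_of_metric
    (isCompact_univ (X := stdSimplex ℝ ι)) hopen fun p _ => mem_iUnion.2 (h p)
  obtain ⟨p, hp⟩ := exists_forall_ne_zero_exists_dist_lt c hε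
  obtain ⟨i, hi⟩ := hball p (mem_univ p)
  obtain ⟨x, hx, rfl⟩ := hp i (hi (Metric.mem_ball_self hε)).1
  exact (hi hx).2 (hc x)

/-- **Brouwer's fixed point theorem** for the standard simplex. -/
theorem exists_fixedPoint_stdSimplex [Nonempty ι] {f : stdSimplex ℝ ι → stdSimplex ℝ ι}
    (hf : Continuous f) : ∃ p, f p = p := by
  have hcoord : ∀ i, Continuous fun x : stdSimplex ℝ ι => x i := fun i =>
    (continuous_apply i).comp continuous_subtype_val
  obtain ⟨p, hp⟩ := exists_forall_ne_zero_mem_of_isClosed (F := fun i => {x | x i ≤ f x i})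
    (fun i => isClosed_le (hcoord i) ((hcoord i).comp hf)) fun x => by
      obtain ⟨i, -, hi⟩ := Finset.exists_le_of_sum_le Finset.univ_nonempty
        (f := fun i => x i) (g := fun i => f x i)
        (by rw [stdSimplex.sum_eq_one, stdSimplex.sum_eq_one])
      exact ⟨i, hi⟩
  have hle : ∀ i, p i ≤ f p i := fun i => by
    by_cases hi : p i = 0
    · exact hi.trans_le (stdSimplex.zero_le (f p) i)
    · exact hp i hi
  have heq : ∀ i ∈ Finset.univ, p i = f p i :=
    (Finset.sum_eq_sum_iff_of_le fun i _ => hle i).1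
      (by rw [stdSimplex.sum_eq_one, stdSimplex.sum_eq_one])
  exact ⟨p, stdSimplex.ext (funext fun i => (heq i (Finset.mem_univ i)).symm)⟩

end Brouwer

namespace SetValuedConvexity

variable {I : Type u} {K : Finset I}

theorem extendByZero_single (k : K) [DecidableEq K] :
    Function.ExtendByZero.linearMap ℝ (Subtype.val : K → I) (Pi.single k 1) =
      unitVec (k : I) := by
  classical
  ext i
  rw [Function.ExtendByZero.linearMap_apply, unitVec]
  by_cases hi : i ∈ K
  · rw [Function.extend_val_apply hi]
    simp [Pi.single_apply, Subtype.ext_iff]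
  · rw [Function.extend_val_apply' hi, Pi.zero_apply,
      Pi.single_eq_of_ne (ne_of_mem_of_not_mem k.2 hi).symm]

theorem image_extendByZero_stdSimplex (K : Finset I) :
    Function.ExtendByZero.linearMap ℝ (Subtype.val : K → I) '' stdSimplex ℝ K =
      face (K : Set I) := by
  classical
  rw [← convexHull_rangle_single_eq_stdSimplex, LinearMap.image_convexHull, ← range_comp, face,
    image_eq_range]
  exact congrArg (fun u => convexHull ℝ (range u)) (funext fun k => extendByZero_single k)

theorem nonempty_homeomorph_face (K : Finset I) :
    Nonempty (stdSimplex ℝ K ≃ₜ face (K : Set I)) := by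
  let E := Function.ExtendByZero.linearMap ℝ (Subtype.val : K → I)
  have hE : Function.Injective E := Function.extend_injective Subtype.val_injective _
  have hemb : IsEmbedding ((stdSimplex ℝ K).domRestrict E) :=
    (E.continuous_on_pi.comp continuous_subtype_val).isClosedEmbedding
      (hE.comp Subtype.val_injective) |>.isEmbedding
  exact ⟨hemb.toHomeomorph.trans (.setCongr
    ((range_domRestrict _ _).trans (image_extendByZero_stdSimplex K)))⟩

theorem exists_fixedPoint_face (hK : K.Nonempty) {g : face (K : Set I) → face (K : Set I)}
    (hg : Continuous g) : ∃ d, g d = d := by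
  have : Nonempty K := hK.to_subtype
  obtain ⟨h⟩ := nonempty_homeomorph_face K
  obtain ⟨x, hx⟩ := exists_fixedPoint_stdSimplex
    (h.symm.continuous.comp (hg.comp h.continuous))
  exact ⟨h x, h.symm_apply_eq.1 hx⟩

end SetValuedConvexity

theorem proposition8p2_general {I : Type u} {Y : Type v} [UniformSpace Y]
    {Z : TopologicalSpace Y} {X : Type w} [TopologicalSpace X]
    (κ : SetValuedConvexity.ContinuousConvexity I Y Z) {Y' : Set Y}
    (hY' : ∀ (d : SetValuedConvexity.bigSimplex I) (a : I → Y), (∀ i, a i ∈ Y') →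
      ∃ h : (d, a) ∈ κ.domain, κ.C ⟨(d, a), h⟩ ⊆ Y')
    (ψ : Y' → X) (hψ : Continuous[Z.induced Subtype.val, _] ψ) :
    (fun y => ({ψ y} : Set X)) ∈ κ.fixedPointClass Y' X := by
  intro K hK a ha f hf
  choose hdom hC using fun d : SetValuedConvexity.face (K : Set I) =>
    hY' (SetValuedConvexity.inclFace d) a ha
  obtain ⟨g, hg, hCg⟩ := κ.C_mem_class a K hK hdom
  have hgC : ∀ d, g d ∈ κ.C ⟨_, hdom d⟩ := fun d => (hCg d).ge rfl
  let g' : SetValuedConvexity.face (K : Set I) → Y' := fun d => ⟨g d, hC d (hgC d)⟩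
  have hg' : Continuous[_, Z.induced Subtype.val] g' := continuous_induced_rng.2 hg
  obtain ⟨d, hd⟩ := SetValuedConvexity.exists_fixedPoint_face hK
    (hf.comp (@Continuous.comp _ _ _ _ (Z.induced Subtype.val) _ _ _ hψ hg'))
  exact ⟨d, hdom d, g' d, hgC d, ψ (g' d), rfl, hd⟩

theorem proposition8p2 {I : Type u} [Infinite I] {Y : Type v} [UniformSpace Y]
    {Z : TopologicalSpace Y} {X : Type w} [TopologicalSpace X]
    (κ : SetValuedConvexity.ContinuousConvexity I Y Z) (hκ : κ.IsGlobal)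
    (ψ : Y → X) (hψ : Continuous[Z, _] ψ) :
    (fun y : (univ : Set Y) => ({ψ y.1} : Set X)) ∈ κ.fixedPointClass (univ : Set Y) X :=
  proposition8p2_general κ (fun _ _ _ => ⟨hκ.ge (mem_univ _), subset_univ _⟩) (fun y => ψ y)
    (@Continuous.comp _ _ _ (Z.induced Subtype.val) Z _ _ _ hψ continuous_induced_dom)
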